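/- Let $\mathcal Y_n$ be the set of rooted planar binary trees with $n$ interior nodes, partially ordered by the Tamari order (its cover relations move a child node directly above a given node from the left to the right branch above that node), and let $\mathcal Y_\infty=\bigsqcup_{n\ge 0}\mathcal Y_n$. Write $|$ for the tree with one leaf. Let $\mathcal{Y}Sym$ be the graded connected coalgebra over $\mathbb Q$ with basis $\{F_t \mid t\in\mathcal Y_\infty\}$ (with $F_t$ in degree $n$ for $t\in\mathcal Y_n$), coproduct $\Delta(F_t)=\sum_{t\to(t_0,t_1)}F_{t_0}\otimes F_{t_1}$, the sum being over the divisions of $t$ into a left and a right piece along the path from one of its $n+1$ leaves to the root, counit the coefficient of $F_|$, and $1:=F_|$. For $t\in\mathcal Y_n$ put $M_t=\sum_{s\in\mathcal Y_n,\ t\le s}\mu_{\mathcal Y_n}(t,s)F_s$, where $\mu_{\mathcal Y_n}$ is the Möbius function. Let $s\backslash t$ be the tree obtained by adjoining the root of $t$ to the rightmost branch of $s$. A tree $t\ne|$ is progressive if $t=t\backslash|$ and $t=|\backslash t$ are its only decompositions of the form $r\backslash s$; a tree $t$ has $k$ progressive components if $t=t_1\backslash\cdots\backslash t_k$ with all $t_i$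 progressive (the tree $|$ has $0$ components). Let $(\mathcal{Y}Sym)^k$ be the span of the $M_t$ where $t$ has exactly $k$ progressive components, and let $V$ be the span of $\{M_t\mid t \text{ progressive}\}$. Let $Q(V)=\bigoplus_{k\ge0}V^{\otimes k}$, graded by $k$, with the deconcatenation coproduct $\Delta(v_1\otimes\cdots\otimes v_k)=\sum_{i=0}^k(v_1\otimes\cdots\otimes v_i)\otimes(v_{i+1}\otimes\cdots\otimes v_k)$ and the counit that vanishes on $V^{\otimes k}$ for $k\ge1$ and is the identity on $V^{\otimes 0}=\mathbb Q$. Then: 1. $\mathcal{Y}Sym=\bigoplus_{k\ge0}(\mathcal{Y}Sym)^k$ is a coalgebra grading: the sum is direct, $\Delta((\mathcal{Y}Sym)^k)\subseteq\sum_{i+j=k}(\mathcal{Y}Sym)^i\otimes(\mathcal{Y}Sym)^j$ for all $k$, and the counit vanishes on $(\mathcal{Y}Sym)^k$ for $k\ne0$. 2. With this grading $\mathcal{Y}Sym$ is isomorphic, as a graded coalgebra, to the cofree graded coalgebra $Q(V)$; an isomorphism $Q(V)\to\mathcal{Y}Sym$ is given by $M_{t_1}\otimes\cdots\otimes M_{t_k}\mapsto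 M_{t_1\backslash\cdots\backslash t_k}$ for $t_1,\dots,t_k$ progressive. 3. The family $M_t$, $t$ progressive, is a linear basis of the space of primitive elements $\{x\mid\Delta(x)=x\otimes1+1\otimes x\}$. 4. For every $k\ge0$, the family $M_t$, $t$ with at most $k$ progressive components, is a linear basis of the $k$-th level $(\Delta^k)^{-1}\bigl(\sum_{i+j=k}C^{\otimes i}\otimes C^0\otimes C^{\otimes j}\bigr)$ of the coradical filtration of $C=\mathcal{Y}Sym$, where $C^0$ (the coradical) is the degree-$0$ component $\mathbb Q F_|$ and $\Delta^k:C\to C^{\otimes(k+1)}$ is the iterated coproduct. -/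

import Mathlib

open scoped TensorProduct DirectSum
open BinaryTree

noncomputable section

/-! ## Planar binary trees and the Tamari order -/

/-- Rooted planar binary trees. The one-leaf tree `|` is `nil`, the grafting `s ∨ t` is `s △ t`
and the number of interior nodes is `numNodes`. -/
abbrev PBTree : Type := BinaryTree Unit

namespace PBTree

/-- `TamariCover s t`: the tree `t` arises from `s` by moving one child node directly above some
given node from the left branch to the right branch above that node. -/
inductive TamariCover : PBTree → PBTree → Prop
  | rotate (a b c : PBTree) : TamariCover ((a △ b) △ c) (a △ (b △ c))
  | left {l l' : PBTree} (r : PBTree) (h : TamariCover l l') : TamariCover (l △ r) (l' △ r)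
  | right (l : PBTree) {r r' : PBTree} (h : TamariCover r r') : TamariCover (l △ r) (l △ r')

/-- An auxiliary statistic that strictly increases along `TamariCover`. -/
def weight : PBTree → ℕ
  | nil => 0
  | node _ l r => weight l + weight r + r.numNodes

theorem TamariCover.numNodes_eq {s t : PBTree} (h : TamariCover s t) :
    s.numNodes = t.numNodes := by
  induction h with
  | rotate a b c => simp only [BinaryTree.numNodes]; omega
  | left r h ih => simp only [BinaryTree.numNodes]; omega
  | right l h ih => simp only [BinaryTree.numNodes]; omega

theorem TamariCover.weight_lt {s t : PBTree} (h : TamariCover s t) : weight s < weight t := by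
  induction h with
  | rotate a b c => simp only [weight, BinaryTree.numNodes]; omega
  | left r h ih => simp only [weight]; omega
  | right l h ih => have := h.numNodes_eq; simp only [weight]; omega

theorem numNodes_eq_of_reflTransGen {s t : PBTree} (h : Relation.ReflTransGen TamariCover s t) :
    s.numNodes = t.numNodes := by
  induction h with
  | refl => rfl
  | tail _ h ih => exact ih.trans h.numNodes_eq

theorem eq_or_weight_lt {s t : PBTree} (h : Relation.ReflTransGen TamariCover s t) :
    s = t ∨ weight s < weight t := by
  induction h with
  | refl => exact Or.inl rfl
  | tail _ h ih =>
    rcases ih with rfl | ih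
    · exact Or.inr h.weight_lt
    · exact Or.inr (ih.trans h.weight_lt)

/-- The Tamari order, on all trees at once; trees with different numbers of nodes are incomparable,
so this is the disjoint union of the Tamari orders on the trees with `n` nodes. -/
instance : PartialOrder PBTree where
  le := Relation.ReflTransGen TamariCover
  le_refl _ := Relation.ReflTransGen.refl
  le_trans _ _ _ := Relation.ReflTransGen.trans
  le_antisymm s t hst hts := by
    rcases eq_or_weight_lt hst with h | h
    · exact h
    · rcases eq_or_weight_lt hts with h' | h'
      · exact h'.symm
      · omega

theorem numNodes_eq_of_le {s t : PBTree} (h : s ≤ t) : s.numNodes = t.numNodes :=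
  numNodes_eq_of_reflTransGen h

open Classical in
instance : LocallyFiniteOrder PBTree :=
  LocallyFiniteOrder.ofIcc PBTree
    (fun s t => (treesOfNumNodesEq s.numNodes).filter fun x => s ≤ x ∧ x ≤ t)
    (fun s t x => by
      simp only [Finset.mem_filter, mem_treesOfNumNodesEq]
      exact ⟨fun h => h.2, fun h => ⟨(numNodes_eq_of_le h.1).symm, h⟩⟩)

/-- `under s t` is the tree `s \ t`: the root of `t` is adjoined to the rightmost branch of `s`. -/
def under : PBTree → PBTree → PBTree
  | nil, t => t
  | node _ l r, t => l △ under r t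

/-- A tree is progressive if it is not `|` and has only the two trivial right decompositions. -/
def IsProgressive (t : PBTree) : Prop :=
  t ≠ nil ∧ ∀ r s : PBTree, t = under r s → r = nil ∨ s = nil

/-- `underList [t₁, …, tₖ] = t₁ \ ⋯ \ tₖ`. -/
def underList (l : List PBTree) : PBTree := l.foldr under nil

/-- `t` has exactly `k` progressive components, i.e. `t = t₁ \ ⋯ \ tₖ` with all `tᵢ` progressive. -/
def HasComponents (t : PBTree) (k : ℕ) : Prop :=
  ∃ l : List PBTree, l.length = k ∧ (∀ s ∈ l, IsProgressive s) ∧ underList l = t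

/-- The ways of dividing a tree along the path from one of its leaves to the root, as the multiset
of pairs (left piece, right piece), one pair for each leaf. -/
def divisions : PBTree → Multiset (PBTree × PBTree)
  | nil => {(nil, nil)}
  | node _ l r =>
      (divisions l).map (fun p => (p.1, p.2 △ r)) + (divisions r).map (fun p => (l △ p.1, p.2))

end PBTree

/-! ## The coalgebra of planar binary trees -/

/-- The rational vector space with fundamental basis `F t`, for `t` a planar binary tree. -/
def YSym : Type := PBTree →₀ ℚ

namespace YSym

instance : AddCommGroup YSym := inferInstanceAs (AddCommGroup (PBTree →₀ ℚ))

instance : Module ℚ YSym := inferInstanceAs (Module ℚ (PBTree →₀ ℚ))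

/-- The fundamental basis. -/
def F : Module.Basis PBTree ℚ YSym := Module.Basis.ofRepr (LinearEquiv.refl ℚ (PBTree →₀ ℚ))

/-- The coproduct `Δ (F t) = ∑ F t₀ ⊗ F t₁`, over all divisions `t → (t₀, t₁)`; the counit
is the coefficient of `F |`. -/
instance : CoalgebraStruct ℚ YSym where
  comul := F.constr ℚ fun t => ((PBTree.divisions t).map fun p => F p.1 ⊗ₜ[ℚ] F p.2).sum
  counit := F.constr ℚ fun t => if t = nil then 1 else 0

theorem comul_F (t : PBTree) : Coalgebra.comul (R := ℚ) (F t) =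
    ((PBTree.divisions t).map fun p => F p.1 ⊗ₜ[ℚ] F p.2).sum :=
  F.constr_basis ℚ _ t

theorem counit_F (t : PBTree) :
    Coalgebra.counit (R := ℚ) (F t) = if t = nil then 1 else 0 :=
  F.constr_basis ℚ _ t

theorem sum_divisions_assoc {A : Type*} [AddCommMonoid A] (t : PBTree)
    (f : PBTree → PBTree → PBTree → A) :
    ((PBTree.divisions t).map fun p =>
        ((PBTree.divisions p.1).map fun q => f q.1 q.2 p.2).sum).sum =
      ((PBTree.divisions t).map fun p =>
        ((PBTree.divisions p.2).map fun q => f p.1 q.1 q.2).sum).sum := by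
  induction t generalizing f with
  | nil => simp [PBTree.divisions]
  | node u l r hl hr =>
    have h1 := hl fun a b c => f a b (c △ r)
    have h2 := hr fun a b c => f (l △ a) b c
    have h3 := Multiset.sum_map_sum_map (PBTree.divisions r) (PBTree.divisions l)
      (f := fun p q => f q.1 (q.2 △ p.1) p.2)
    simp only [PBTree.divisions, Multiset.map_add, Multiset.sum_add, Multiset.map_map,
      Function.comp_def, Multiset.sum_map_add] at h1 h2 h3 ⊢
    rw [h1, h2, h3]
    abel

theorem sum_divisions_left {A : Type*} [AddCommMonoid A] (t : PBTree) (f : PBTree → A) :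
    ((PBTree.divisions t).map fun p => if p.1 = nil then f p.2 else 0).sum = f t := by
  induction t generalizing f with
  | nil => simp [PBTree.divisions]
  | node u l r hl hr =>
    have h1 := hl fun a => f (a △ r)
    simp [PBTree.divisions, h1]

theorem sum_divisions_right {A : Type*} [AddCommMonoid A] (t : PBTree) (f : PBTree → A) :
    ((PBTree.divisions t).map fun p => if p.2 = nil then f p.1 else 0).sum = f t := by
  induction t generalizing f with
  | nil => simp [PBTree.divisions]
  | node u l r hl hr =>
    have h1 := hr fun a => f (l △ a)
    simp [PBTree.divisions, h1]

instance : Coalgebra ℚ YSym where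
  coassoc := by
    refine F.ext fun t => ?_
    have h := sum_divisions_assoc t fun a b c => F a ⊗ₜ[ℚ] (F b ⊗ₜ[ℚ] F c)
    have h1 (a : Multiset (PBTree × PBTree)) (c : PBTree) :
        (TensorProduct.assoc ℚ YSym YSym YSym)
          ((a.map fun q => F q.1 ⊗ₜ[ℚ] F q.2).sum ⊗ₜ[ℚ] F c) =
        (a.map fun q => F q.1 ⊗ₜ[ℚ] (F q.2 ⊗ₜ[ℚ] F c)).sum := by
      induction a using Multiset.induction with
      | empty => simp
      | cons p a ih => simp [TensorProduct.add_tmul, ih]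
    have h2 (a : Multiset (PBTree × PBTree)) (c : PBTree) :
        F c ⊗ₜ[ℚ] (a.map fun q => F q.1 ⊗ₜ[ℚ] F q.2).sum =
        (a.map fun q => F c ⊗ₜ[ℚ] (F q.1 ⊗ₜ[ℚ] F q.2)).sum := by
      induction a using Multiset.induction with
      | empty => simp
      | cons p a ih => simp [TensorProduct.tmul_add, ih]
    simpa only [LinearMap.comp_apply, LinearEquiv.coe_coe, comul_F, map_multiset_sum,
      Multiset.map_map, Function.comp_def, LinearMap.rTensor_tmul, LinearMap.lTensor_tmul,
      h1, h2] using h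
  rTensor_counit_comp_comul := by
    refine F.ext fun t => ?_
    have h := sum_divisions_left t fun a => (1 : ℚ) ⊗ₜ[ℚ] F a
    rw [LinearMap.comp_apply, comul_F, map_multiset_sum, Multiset.map_map]
    simp only [Function.comp_def, LinearMap.rTensor_tmul, counit_F, TensorProduct.ite_tmul,
      TensorProduct.mk_apply]
    simpa using h
  lTensor_counit_comp_comul := by
    refine F.ext fun t => ?_
    have h := sum_divisions_right t fun a => F a ⊗ₜ[ℚ] (1 : ℚ)
    rw [LinearMap.comp_apply, comul_F, map_multiset_sum, Multiset.map_map]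
    simp only [Function.comp_def, LinearMap.lTensor_tmul, counit_F, TensorProduct.tmul_ite]
    simpa using h

open Classical in
/-- The monomial basis elements `M t = ∑_{t ≤ s} μ(t, s) F s`, with `μ` the Möbius function of
the Tamari order. -/
def M (t : PBTree) : YSym :=
  ∑ s ∈ (treesOfNumNodesEq t.numNodes).filter (fun s => t ≤ s),
    IncidenceAlgebra.mu ℚ t s • F s

/-- The homogeneous component of degree `n`: the span of the `F t`, `t` with `n` nodes. -/
def homogeneous (n : ℕ) : Submodule ℚ YSym :=
  Submodule.span ℚ (F '' {t | t.numNodes = n})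

/-- The span of the `M t` where `t` has exactly `k` progressive components. -/
def componentGrading (k : ℕ) : Submodule ℚ YSym :=
  Submodule.span ℚ (M '' {t | t.HasComponents k})

/-- The span of the `M t` where `t` is progressive. -/
def progressiveSpan : Submodule ℚ YSym :=
  Submodule.span ℚ (M '' {t | t.IsProgressive})

/-- The element `M t` of `progressiveSpan`, for `t` progressive. -/
def progressiveM (t : {t : PBTree // t.IsProgressive}) : progressiveSpan :=
  ⟨M t, Submodule.subset_span ⟨t, t.2, rfl⟩⟩

end YSym

/-! ## The deconcatenation coalgebra -/

/-- The space `Q(V) = ⨁ₖ V^{⊗k}`. -/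
def Cofree (V : Type*) [AddCommGroup V] [Module ℚ V] : Type _ := ⨁ k : ℕ, ⨂[ℚ]^k V

namespace Cofree

variable (V : Type*) [AddCommGroup V] [Module ℚ V]

instance : AddCommGroup (Cofree V) := inferInstanceAs (AddCommGroup (⨁ k : ℕ, ⨂[ℚ]^k V))

instance : Module ℚ (Cofree V) := inferInstanceAs (Module ℚ (⨁ k : ℕ, ⨂[ℚ]^k V))

/-- The inclusion of the summand `V^{⊗k}`. -/
def incl (k : ℕ) : ⨂[ℚ]^k V →ₗ[ℚ] Cofree V := DirectSum.lof ℚ ℕ (fun k => ⨂[ℚ]^k V) k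

/-- The homogeneous component `V^{⊗k}` of `Q(V)`. -/
def homogeneous (k : ℕ) : Submodule ℚ (Cofree V) := LinearMap.range (incl V k)

/-- The element `v₁ ⊗ ⋯ ⊗ vₖ` of `V^{⊗k} ⊆ Q(V)`, as a multilinear map of `v₁, …, vₖ`. -/
def tensor (k : ℕ) : MultilinearMap ℚ (fun _ : Fin k => V) (Cofree V) :=
  (incl V k).compMultilinearMap (PiTensorProduct.tprod ℚ)

/-- The `i`-th term `(v₁ ⊗ ⋯ ⊗ vᵢ) ⊗ (vᵢ₊₁ ⊗ ⋯ ⊗ vₖ)` of the deconcatenation coproduct. -/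
def cut (k : ℕ) (i : Fin (k + 1)) :
    MultilinearMap ℚ (fun _ : Fin k => V) (Cofree V ⊗[ℚ] Cofree V) :=
  ((tensor V i).domCoprod (tensor V (k - i))).domDomCongr
    (finSumFinEquiv.trans (finCongr (Nat.add_sub_of_le (Nat.le_of_lt_succ i.2))))

/-- The deconcatenation coproduct, and the counit that vanishes on `V^{⊗k}` for `k ≥ 1` and
sends the empty tensor to `1`. -/
instance : CoalgebraStruct ℚ (Cofree V) where
  comul := DirectSum.toModule ℚ ℕ (Cofree V ⊗[ℚ] Cofree V) fun k =>
    PiTensorProduct.lift (∑ i : Fin (k + 1), cut V k i)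
  counit := DirectSum.toModule ℚ ℕ ℚ fun k =>
    match k with
    | 0 => (PiTensorProduct.isEmptyEquiv (Fin 0)).toLinearMap
    | _ + 1 => 0

variable {V}

theorem comul_tensor {k : ℕ} (v : Fin k → V) :
    Coalgebra.comul (R := ℚ) (tensor V k v) =
      ∑ i : Fin (k + 1),
        tensor V i (fun a => v (Fin.castLE (Nat.le_of_lt_succ i.2) a)) ⊗ₜ[ℚ]
          tensor V (k - i) (fun b => v ⟨i + b, by omega⟩) := by
  refine (DirectSum.toModule_lof ℚ k _).trans ?_
  rw [PiTensorProduct.lift.tprod, sum_apply]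
  rfl

theorem counit_tensor {k : ℕ} (v : Fin k → V) :
    Coalgebra.counit (R := ℚ) (tensor V k v) = if k = 0 then 1 else 0 := by
  refine (DirectSum.toModule_lof ℚ k _).trans ?_
  cases k with
  | zero => simp
  | succ k => simp

/-- The tensor `v₁ ⊗ ⋯ ⊗ vₖ` of a list of vectors. -/
def word (l : List V) : Cofree V := tensor V l.length l.get

theorem tensor_eq_word {k : ℕ} (v : Fin k → V) : tensor V k v = word (List.ofFn v) := by
  have h : ∀ (l : List V) (hl : l.length = k) (_ : ∀ i : Fin k, v i = l.get (Fin.cast hl.symm i)),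
      tensor V k v = word l := by
    rintro l rfl h
    exact congrArg _ (funext h)
  exact h _ (by simp) (by simp)

theorem hom_ext {A : Type*} [AddCommMonoid A] [Module ℚ A] {f g : Cofree V →ₗ[ℚ] A}
    (h : ∀ l : List V, f (word l) = g (word l)) : f = g := by
  refine DirectSum.linearMap_ext ℚ fun k => PiTensorProduct.ext (MultilinearMap.ext fun v => ?_)
  have := h (List.ofFn v)
  rw [← tensor_eq_word] at this
  exact this

theorem comul_word (l : List V) :
    Coalgebra.comul (R := ℚ) (word l) =
      ∑ i ∈ Finset.range (l.length + 1), word (l.take i) ⊗ₜ[ℚ] word (l.drop i) := by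
  rw [word, comul_tensor, Finset.sum_range]
  refine Finset.sum_congr rfl fun i _ => ?_
  rw [tensor_eq_word, tensor_eq_word]
  congr 2
  · refine List.ext_getElem (by have := i.2; rw [List.length_ofFn, List.length_take]; omega) fun n h1 h2 => by simp
  · refine List.ext_getElem (by simp) fun n h1 h2 => by simp

theorem counit_word (l : List V) :
    Coalgebra.counit (R := ℚ) (word l) = if l.length = 0 then 1 else 0 :=
  counit_tensor _

instance : Coalgebra ℚ (Cofree V) where
  coassoc := by
    refine hom_ext fun l => ?_
    simp only [LinearMap.comp_apply, LinearEquiv.coe_coe, comul_word, map_sum,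
      LinearMap.rTensor_tmul, LinearMap.lTensor_tmul, TensorProduct.sum_tmul,
      TensorProduct.tmul_sum, TensorProduct.assoc_tmul]
    rw [Finset.sum_sigma', Finset.sum_sigma']
    refine Finset.sum_bij' (fun x _ => ⟨x.2, x.1 - x.2⟩) (fun x _ => ⟨x.1 + x.2, x.1⟩) ?_ ?_ ?_ ?_ ?_
    · rintro ⟨i, j⟩ h
      simp at h ⊢
      omega
    · rintro ⟨i, j⟩ h
      simp at h ⊢
      omega
    · rintro ⟨i, j⟩ h
      simp at h ⊢
      omega
    · rintro ⟨i, j⟩ h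
      simp
    · rintro ⟨i, j⟩ h
      simp only [Finset.mem_sigma, Finset.mem_range, List.length_take] at h
      have h1 : min j i = j := by omega
      have h2 : j + (i - j) = i := by omega
      simp [List.take_take, List.drop_take, h1, h2]
  rTensor_counit_comp_comul := by
    refine hom_ext fun l => ?_
    simp only [LinearMap.comp_apply, comul_word, map_sum, LinearMap.rTensor_tmul, counit_word,
      TensorProduct.mk_apply]
    rw [Finset.sum_eq_single 0]
    · simp
    · intro i hi h0
      simp only [Finset.mem_range] at hi
      rw [if_neg (by rw [List.length_take]; omega), TensorProduct.zero_tmul]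
    · simp
  lTensor_counit_comp_comul := by
    refine hom_ext fun l => ?_
    simp only [LinearMap.comp_apply, comul_word, map_sum, LinearMap.lTensor_tmul, counit_word,
      TensorProduct.mk_apply, LinearMap.flip_apply]
    rw [Finset.sum_eq_single l.length]
    · simp
    · intro i hi h0
      simp only [Finset.mem_range] at hi
      rw [if_neg (by rw [List.length_drop]; omega), TensorProduct.tmul_zero]
    · simp

end Cofree

/-! ## Gradings, primitive elements and the coradical filtration of a coalgebra -/

section Coalgebra

variable {C : Type*} [AddCommGroup C] [Module ℚ C] [Coalgebra ℚ C]

/-- A coalgebra grading: a direct sum decomposition `C = ⨁ₖ 𝒢 k` such that `Δ (𝒢 k)` is contained in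
`∑_{i+j=k} 𝒢 i ⊗ 𝒢 j` and the counit vanishes on `𝒢 k` for `k ≠ 0`. -/
structure IsCoalgebraGrading (𝒢 : ℕ → Submodule ℚ C) : Prop where
  isInternal : DirectSum.IsInternal 𝒢
  comul_le (k : ℕ) : (𝒢 k).map (Coalgebra.comul (R := ℚ)) ≤
    ⨆ p ∈ Finset.HasAntidiagonal.antidiagonal k,
      LinearMap.range (TensorProduct.map (𝒢 p.1).subtype (𝒢 p.2).subtype)
  counit_eq_zero (k : ℕ) (hk : k ≠ 0) (x : C) (hx : x ∈ 𝒢 k) : Coalgebra.counit (R := ℚ) x = 0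

/-- The elements that are primitive with respect to `one`: `Δ x = x ⊗ 1 + 1 ⊗ x`. -/
def primitives (one : C) : Submodule ℚ C where
  carrier := {x | Coalgebra.comul (R := ℚ) x = x ⊗ₜ[ℚ] one + one ⊗ₜ[ℚ] x}
  zero_mem' := by simp
  add_mem' {x y} hx hy := by
    simp only [Set.mem_ofPred_eq] at hx hy ⊢
    rw [map_add, hx, hy, TensorProduct.add_tmul, TensorProduct.tmul_add]
    abel
  smul_mem' c x hx := by
    simp only [Set.mem_ofPred_eq] at hx ⊢
    rw [map_smul, hx, smul_add, TensorProduct.smul_tmul', TensorProduct.tmul_smul]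

variable (C) in
/-- The iterated coproduct `Δ^k : C → C^{⊗(k+1)}`, with `Δ^0` the identity. -/
def iterComul : (k : ℕ) → C →ₗ[ℚ] ⨂[ℚ]^(k + 1) C
  | 0 => (PiTensorProduct.subsingletonEquiv (R := ℚ) (s := fun _ : Fin 1 => C) 0).symm.toLinearMap
  | k + 1 => TensorPower.mulEquiv.toLinearMap ∘ₗ
      TensorProduct.map (iterComul k)
        (PiTensorProduct.subsingletonEquiv (R := ℚ) (s := fun _ : Fin 1 => C) 0).symm.toLinearMap ∘ₗ
      Coalgebra.comul (R := ℚ)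

/-- The `k`-th level `(Δ^k)⁻¹ (∑_{i+j=k} C^{⊗i} ⊗ C₀ ⊗ C^{⊗j})` of the coradical filtration of a
coalgebra with coradical `C₀`. -/
def coradicalLevel (C₀ : Submodule ℚ C) (k : ℕ) : Submodule ℚ C :=
  Submodule.comap (iterComul C k)
    (⨆ i : Fin (k + 1),
      Submodule.span ℚ {x | ∃ v : Fin (k + 1) → C, v i ∈ C₀ ∧ x = PiTensorProduct.tprod ℚ v})

end Coalgebra

end

/-! The key is a Galois connection. Dividing a tree at a fixed leaf is monotone for the Tamari
order, a tree lies below `s \ t` for the two pieces of each of its divisions, and dividing `a \ b`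
at its leaf number `|a|` returns `(a, b)`. Hence `t ≤ a \ b` if and only if the division of `t` at
leaf `|a|` is `≤ (a, b)` (`le_under_iff`). By Möbius inversion `F t` is the sum of the `M s` with `s
≥ t`. Expanding both factors of `Δ (F t)` this way and applying the Galois connection gives the sum
of `M a ⊗ M b` over all pairs with `t ≤ a \ b`; inverting again, `Δ (M s)` is the sum of `M a ⊗ M b`
over all `s = a \ b`. Progressive trees are those whose root has an empty right branch, so trees are
the same as words in progressive trees, with `\` as concatenation (`componentsEquiv`), and `Δ`
deconcatenates words (`comul_monomialBasis`). All claims then hold for any coalgebra with a basis of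
words on which `Δ` is deconcatenation (`IsDeconcatenation`): its coordinate functionals turn `Δ`
into concatenation, which determines the primitives and the coradical levels. `Q(V)` has such a
basis over the same alphabet, and matching the two bases gives the isomorphism. -/

namespace PBTree

/-! ### Monotonicity of grafting -/

@[simp]
theorem numNodes_node (u : Unit) (l r : PBTree) :
    (node u l r).numNodes = l.numNodes + r.numNodes + 1 := rfl

theorem node_mono {l l' r r' : PBTree} (hl : l ≤ l') (hr : r ≤ r') : l △ r ≤ l' △ r' := by
  have h1 : l △ r ≤ l' △ r :=
    Relation.ReflTransGen.lift (· △ r) (fun _ _ h => TamariCover.left r h) _ _ hl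
  have h2 : l' △ r ≤ l' △ r' :=
    Relation.ReflTransGen.lift (l' △ ·) (fun _ _ h => TamariCover.right l' h) _ _ hr
  exact h1.trans h2

theorem rotate_le (a b c : PBTree) : (a △ b) △ c ≤ a △ (b △ c) :=
  Relation.ReflTransGen.single (.rotate a b c)

/-! ### The operation `under` -/

theorem under_nil (t : PBTree) : under t nil = t := by
  induction t with
  | nil => rfl
  | node u l r _ ih => rw [under, ih]

theorem under_assoc (a b c : PBTree) : under (under a b) c = under a (under b c) := by
  induction a with
  | nil => rfl
  | node u l r _ ih => simp only [under, ih]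

theorem numNodes_under (s t : PBTree) : (under s t).numNodes = s.numNodes + t.numNodes := by
  induction s with
  | nil => simp [under]
  | node u l r _ ih => simp only [under, numNodes_node, ih]; omega

/-- One rotation for each node on the rightmost branch of `a` carries the new root down past that
branch. -/
theorem node_under_le (a b c : PBTree) : (under a b) △ c ≤ under a (b △ c) := by
  induction a with
  | nil => exact le_rfl
  | node u l r _ ih => exact (rotate_le l (under r b) c).trans (node_mono le_rfl ih)

theorem under_mono_right (s : PBTree) {t t' : PBTree} (h : t ≤ t') : under s t ≤ under s t' := by
  induction s with
  | nil => exact h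
  | node u l r _ ih => exact node_mono le_rfl ih

theorem under_mono_left {s s' : PBTree} (t : PBTree) (h : s ≤ s') : under s t ≤ under s' t := by
  have key : ∀ {s s' : PBTree}, TamariCover s s' → under s t ≤ under s' t := by
    intro s s' h
    induction h with
    -- Adjoining `t` alters only the rightmost branch, so the same rotation applies with `c`
    -- replaced by `c \ t`.
    | rotate a b c => exact rotate_le a b (under c t)
    | left r h _ => exact node_mono (Relation.ReflTransGen.single h) le_rfl
    | right l _ ih => exact node_mono le_rfl ih
  induction h with
  | refl => exact le_rfl
  | tail _ h ih => exact ih.trans (key h)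

theorem under_mono {s s' t t' : PBTree} (hs : s ≤ s') (ht : t ≤ t') : under s t ≤ under s' t' :=
  (under_mono_left t hs).trans (under_mono_right s' ht)

theorem isProgressive_node_nil (l : PBTree) : IsProgressive (l △ nil) := by
  refine ⟨by simp, fun r s h => ?_⟩
  cases r with
  | nil => exact Or.inl rfl
  | node u a b =>
    right
    have h2 : nil = under b s := by simpa [under] using (node.inj h).2.2
    cases b with
    | nil => exact h2.symm
    | node => exact absurd h2 (by simp [under])

/-- Every `l △ r` decomposes as `(l △ nil) \ r`, so being progressive forces `r = nil`. -/
theorem IsProgressive.exists_eq {t : PBTree} (h : IsProgressive t) : ∃ l, t = l △ nil := by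
  cases t with
  | nil => exact absurd rfl h.1
  | node u l r =>
    rcases h.2 (l △ nil) r rfl with h | rfl
    · cases h
    · exact ⟨l, rfl⟩

/-- The tree with the given progressive components. -/
def ofComponents (w : List {t : PBTree // t.IsProgressive}) : PBTree :=
  underList (w.map Subtype.val)

theorem ofComponents_cons (a : {t : PBTree // t.IsProgressive})
    (w : List {t : PBTree // t.IsProgressive}) :
    ofComponents (a :: w) = under a (ofComponents w) := rfl

theorem ofComponents_append (v w : List {t : PBTree // t.IsProgressive}) :
    ofComponents (v ++ w) = under (ofComponents v) (ofComponents w) := by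
  induction v with
  | nil => rfl
  | cons a v ih => rw [List.cons_append, ofComponents_cons, ih, ofComponents_cons, under_assoc]

/-- The progressive components of a tree. -/
def components : PBTree → List {t : PBTree // t.IsProgressive}
  | nil => []
  | node _ l r => ⟨l △ nil, isProgressive_node_nil l⟩ :: components r

/-- Every tree is uniquely determined by its progressive components. -/
def componentsEquiv : List {t : PBTree // t.IsProgressive} ≃ PBTree where
  toFun := ofComponents
  invFun := components
  left_inv w := by
    induction w with
    | nil => rfl
    | cons a w ih =>
      obtain ⟨a, ha⟩ := a
      obtain ⟨l, rfl⟩ := ha.exists_eq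
      simp only [ofComponents_cons, under, components, ih]
  right_inv t := by
    induction t with
    | nil => rfl
    | node u l r _ ih => simp only [components, ofComponents_cons, under, ih]

@[simp]
theorem componentsEquiv_apply (w : List {t : PBTree // t.IsProgressive}) :
    componentsEquiv w = ofComponents w := rfl

theorem hasComponents_iff (t : PBTree) (k : ℕ) :
    t.HasComponents k ↔ (componentsEquiv.symm t).length = k := by
  constructor
  · rintro ⟨l, rfl, hl, rfl⟩
    have h : ofComponents (l.attach.map fun s => ⟨s.1, hl s.1 s.2⟩) = underList l := by
      rw [ofComponents, List.map_map]
      exact congrArg underList (List.attach_map_subtype_val l)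
    rw [← h, ← componentsEquiv_apply, Equiv.symm_apply_apply]
    simp
  · rintro rfl
    refine ⟨(componentsEquiv.symm t).map Subtype.val, by simp, ?_, componentsEquiv.right_inv t⟩
    intro s hs
    obtain ⟨a, -, rfl⟩ := List.mem_map.1 hs
    exact a.2

/-! ### Divisions and the Tamari order -/

/-- The division of `t` along the path from its `i`-th leaf to the root. -/
def divide : ℕ → PBTree → PBTree × PBTree
  | _, nil => (nil, nil)
  | i, node _ l r =>
      if i ≤ l.numNodes then ((divide i l).1, (divide i l).2 △ r)
      else (l △ (divide (i - (l.numNodes + 1)) r).1, (divide (i - (l.numNodes + 1)) r).2)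

theorem divide_of_le {i : ℕ} {l : PBTree} (h : i ≤ l.numNodes) (r : PBTree) :
    divide i (l △ r) = ((divide i l).1, (divide i l).2 △ r) := by
  rw [divide, if_pos h]

theorem divide_add (l r : PBTree) (j : ℕ) :
    divide (l.numNodes + 1 + j) (l △ r) = (l △ (divide j r).1, (divide j r).2) := by
  rw [divide, if_neg (by omega), Nat.add_sub_cancel_left]

/-- Numbering the leaves from left to right makes divisions of different trees comparable at the
same leaf, which the multiset alone does not allow. -/
theorem divisions_eq (t : PBTree) :
    divisions t = (Multiset.range (t.numNodes + 1)).map (fun i => divide i t) := by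
  induction t with
  | nil => rfl
  | node u l r hl hr =>
    rw [divisions, hl, hr, numNodes_node, show l.numNodes + r.numNodes + 1 + 1 =
      (l.numNodes + 1) + (r.numNodes + 1) by omega,
      Multiset.range_add (l.numNodes + 1), Multiset.map_add,
      Multiset.map_map, Multiset.map_map, Multiset.map_map]
    congr 1
    · refine Multiset.map_congr rfl fun i hi => ?_
      rw [Multiset.mem_range] at hi
      exact (divide_of_le (by omega) r).symm
    · exact Multiset.map_congr rfl fun i _ => (divide_add l r i).symm

theorem numNodes_divide_fst {i : ℕ} {t : PBTree} (h : i ≤ t.numNodes) :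
    (divide i t).1.numNodes = i := by
  induction t generalizing i with
  | nil => simp at h; simp [divide, h]
  | node u l r hl hr =>
    rw [numNodes_node] at h
    rcases le_or_gt i l.numNodes with hi | hi
    · rw [divide_of_le hi]; exact hl hi
    · obtain ⟨j, rfl⟩ := Nat.exists_eq_add_of_le (Nat.succ_le_of_lt hi)
      rw [Nat.succ_eq_add_one, divide_add]
      simp only [numNodes_node, hr (show j ≤ r.numNodes by omega)]
      omega

/-- The unit of the Galois connection; `divide_under` below says that its counit is an equality. -/
theorem le_under_divide (i : ℕ) (t : PBTree) : t ≤ under (divide i t).1 (divide i t).2 := by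
  induction t generalizing i with
  | nil => exact le_rfl
  | node u l r hl hr =>
    rcases le_or_gt i l.numNodes with hi | hi
    · rw [divide_of_le hi]
      exact (node_mono (hl i) le_rfl).trans (node_under_le _ _ _)
    · obtain ⟨j, rfl⟩ := Nat.exists_eq_add_of_le (Nat.succ_le_of_lt hi)
      rw [Nat.succ_eq_add_one, divide_add]
      exact node_mono le_rfl (hr j)

theorem divide_zero (t : PBTree) : divide 0 t = (nil, t) := by
  induction t with
  | nil => rfl
  | node u l r hl hr => rw [divide_of_le (Nat.zero_le _), hl]

theorem divide_under (a b : PBTree) : divide a.numNodes (under a b) = (a, b) := by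
  induction a with
  | nil => exact divide_zero b
  | node u l r hl hr =>
    rw [numNodes_node, show l.numNodes + r.numNodes + 1 = l.numNodes + 1 + r.numNodes by omega,
      under, divide_add, hr]

theorem TamariCover.divide_le {s t : PBTree} (h : TamariCover s t) (i : ℕ) :
    divide i s ≤ divide i t := by
  induction h generalizing i with
  | rotate a b c =>
    -- If the leaf lies in `a`, the rotation survives in the right piece; if in `b`, both divisions
    -- agree; if in `c`, it survives in the left piece.
    rcases le_or_gt i a.numNodes with ha | ha
    · rw [divide_of_le (by rw [numNodes_node]; omega), divide_of_le ha, divide_of_le ha]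
      exact ⟨le_rfl, rotate_le _ _ _⟩
    obtain ⟨j, rfl⟩ := Nat.exists_eq_add_of_le (Nat.succ_le_of_lt ha)
    rw [Nat.succ_eq_add_one, divide_add]
    rcases le_or_gt j b.numNodes with hb | hb
    · rw [divide_of_le (by rw [numNodes_node]; omega), divide_add, divide_of_le hb]
    obtain ⟨k, rfl⟩ := Nat.exists_eq_add_of_le (Nat.succ_le_of_lt hb)
    rw [Nat.succ_eq_add_one, divide_add, show a.numNodes + 1 + (b.numNodes + 1 + k) =
      (a △ b).numNodes + 1 + k by rw [numNodes_node]; omega, divide_add]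
    exact ⟨rotate_le _ _ _, le_rfl⟩
  | @left l l' r h ih =>
    -- Moves preserve the number of nodes, so the leaf numbers to the right of `l` do not shift.
    have hn := h.numNodes_eq
    rcases le_or_gt i l.numNodes with hi | hi
    · rw [divide_of_le hi, divide_of_le (hn ▸ hi)]
      exact ⟨(ih i).1, node_mono (ih i).2 le_rfl⟩
    · obtain ⟨j, rfl⟩ := Nat.exists_eq_add_of_le (Nat.succ_le_of_lt hi)
      rw [Nat.succ_eq_add_one, divide_add, hn, divide_add]
      exact ⟨node_mono (Relation.ReflTransGen.single h) le_rfl, le_rfl⟩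
  | @right l r r' h ih =>
    rcases le_or_gt i l.numNodes with hi | hi
    · rw [divide_of_le hi, divide_of_le hi]
      exact ⟨le_rfl, node_mono le_rfl (Relation.ReflTransGen.single h)⟩
    · obtain ⟨j, rfl⟩ := Nat.exists_eq_add_of_le (Nat.succ_le_of_lt hi)
      rw [Nat.succ_eq_add_one, divide_add, divide_add]
      exact ⟨node_mono le_rfl (ih j).1, (ih j).2⟩

theorem divide_mono {s t : PBTree} (h : s ≤ t) (i : ℕ) : divide i s ≤ divide i t := by
  induction h with
  | refl => exact le_rfl
  | tail _ h ih => exact ih.trans (h.divide_le i)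

/-- Division along the leaf with `|a|` nodes to its left is left adjoint to `under` on pairs of trees
whose left member has as many nodes as `a`. -/
theorem le_under_iff (t a b : PBTree) : t ≤ under a b ↔ divide a.numNodes t ≤ (a, b) := by
  constructor
  · intro h
    rw [← divide_under a b]
    exact divide_mono h _
  · intro h
    exact (le_under_divide _ t).trans (under_mono h.1 h.2)

end PBTree
-- Möbius inversion and the coproduct of the monomial basis
namespace PBTree

/-- The components of `s \ t` are those of `s` followed by those of `t`. -/
theorem componentsEquiv_symm_under (s t : PBTree) :
    componentsEquiv.symm (under s t) = componentsEquiv.symm s ++ componentsEquiv.symm t := by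
  rw [Equiv.symm_apply_eq, componentsEquiv_apply, ofComponents_append, ← componentsEquiv_apply,
    ← componentsEquiv_apply, Equiv.apply_symm_apply, Equiv.apply_symm_apply]

/-- The set of trees above `t` in the Tamari order. -/
noncomputable def upper (t : PBTree) : Finset PBTree := by
  classical exact (treesOfNumNodesEq t.numNodes).filter (t ≤ ·)

@[simp]
theorem mem_upper {s t : PBTree} : s ∈ upper t ↔ t ≤ s := by
  simp only [upper, Finset.mem_filter, mem_treesOfNumNodesEq, and_iff_right_iff_imp]
  exact fun h => (numNodes_eq_of_le h).symm

/-- After the exchange the inner sum runs over an interval, where the defining identities of the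
Möbius function apply. -/
theorem sum_upper_upper {A : Type*} [AddCommMonoid A] (t : PBTree) (f : PBTree → PBTree → A) :
    ∑ s ∈ upper t, ∑ u ∈ upper s, f s u = ∑ u ∈ upper t, ∑ s ∈ Finset.Icc t u, f s u := by
  refine Finset.sum_comm' fun x y => ?_
  simp only [mem_upper, Finset.mem_Icc]
  exact ⟨fun h => ⟨h, h.1.trans h.2⟩, fun h => h.1⟩

end PBTree

namespace YSym

open PBTree

theorem M_eq (t : PBTree) : M t = ∑ s ∈ upper t, IncidenceAlgebra.mu ℚ t s • F s := by
  rw [M, upper]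

theorem sum_M (t : PBTree) : ∑ s ∈ upper t, M s = F t := by
  simp only [M_eq]
  rw [sum_upper_upper t fun s u => IncidenceAlgebra.mu ℚ s u • F u]
  simp only [← Finset.sum_smul, IncidenceAlgebra.sum_Icc_mu_left, ite_smul, one_smul, zero_smul]
  rw [Finset.sum_ite_eq, if_pos (mem_upper.2 le_rfl)]

/-- Together with `sum_M`, this shows that the Möbius and zeta transforms are mutually inverse, so
the `M t` form a basis. -/
theorem sum_mu_sum_F (t : PBTree) :
    ∑ s ∈ upper t, IncidenceAlgebra.mu ℚ t s • ∑ u ∈ upper s, F u = F t := by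
  simp only [Finset.smul_sum]
  rw [sum_upper_upper t fun s u => IncidenceAlgebra.mu ℚ t s • F u]
  simp only [← Finset.sum_smul, IncidenceAlgebra.sum_Icc_mu_right, ite_smul, one_smul, zero_smul]
  rw [Finset.sum_ite_eq, if_pos (mem_upper.2 le_rfl)]

/-- The automorphism of the vector space `YSym` with `F t ↦ M t`. -/
noncomputable def fundamentalToMonomial : YSym ≃ₗ[ℚ] YSym :=
  LinearEquiv.ofLinearMap (F.constr ℚ M) (F.constr ℚ fun t => ∑ s ∈ upper t, F s)
    (F.ext fun t => by
      simp only [LinearMap.comp_apply, F.constr_basis, map_sum, LinearMap.id_apply]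
      exact sum_M t)
    (F.ext fun t => by
      simp only [LinearMap.comp_apply, F.constr_basis, M_eq t, map_sum, map_smul,
        LinearMap.id_apply]
      exact sum_mu_sum_F t)

/-- The monomial basis, indexed by the lists of progressive components. -/
noncomputable def monomialBasis : Module.Basis (List {t : PBTree // t.IsProgressive}) ℚ YSym :=
  (F.map fundamentalToMonomial).reindex componentsEquiv.symm

theorem monomialBasis_apply (w : List {t : PBTree // t.IsProgressive}) :
    monomialBasis w = M (ofComponents w) := by
  rw [monomialBasis, Module.Basis.reindex_apply, Module.Basis.map_apply]
  exact F.constr_basis ℚ M _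

theorem monomialBasis_symm_apply (t : PBTree) :
    monomialBasis (componentsEquiv.symm t) = M t := by
  rw [monomialBasis_apply, ← componentsEquiv_apply, Equiv.apply_symm_apply]

theorem comul_F_eq_sum (t : PBTree) : Coalgebra.comul (R := ℚ) (F t) =
    ∑ i ∈ Finset.range (t.numNodes + 1), F (divide i t).1 ⊗ₜ[ℚ] F (divide i t).2 := by
  rw [comul_F, divisions_eq, Multiset.map_map]
  rfl

/-- The bridge from trees to words: for the tree `s` with components `w`, the factorizations `s = a
\ b` are exactly the cuts of `w`. -/
theorem comul_monomialBasis (w : List {t : PBTree // t.IsProgressive}) :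
    Coalgebra.comul (R := ℚ) (monomialBasis w) =
      ∑ i ∈ Finset.range (w.length + 1),
        monomialBasis (w.take i) ⊗ₜ[ℚ] monomialBasis (w.drop i) := by
  -- The identity is linear, so it may be tested on the `F t`, whose coproduct is known.
  suffices h : Coalgebra.comul (R := ℚ) = monomialBasis.constr ℚ fun w =>
      ∑ i ∈ Finset.range (w.length + 1),
        monomialBasis (w.take i) ⊗ₜ[ℚ] monomialBasis (w.drop i) by
    rw [h, Module.Basis.constr_basis]
  refine F.ext fun t => ?_
  rw [comul_F_eq_sum, ← sum_M t, map_sum]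
  simp only [← sum_M (divide _ t).1, ← sum_M (divide _ t).2, ← monomialBasis_symm_apply,
    Module.Basis.constr_basis, TensorProduct.sum_tmul, TensorProduct.tmul_sum]
  simp only [← Finset.sum_product_right']
  rw [Finset.sum_sigma', Finset.sum_sigma']
  have hc (s : PBTree) (i : ℕ) : under (ofComponents ((componentsEquiv.symm s).take i))
      (ofComponents ((componentsEquiv.symm s).drop i)) = s := by
    rw [← ofComponents_append, List.take_append_drop, ← componentsEquiv_apply,
      Equiv.apply_symm_apply]
  -- A leaf `j` with trees `a`, `b` above the two pieces corresponds to the tree `s = a \ b` above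
  -- `t` with a cut after the components of `a`.
  refine Finset.sum_bij'
    (fun x _ => ⟨under x.2.1 x.2.2, (componentsEquiv.symm x.2.1).length⟩)
    (fun x _ => ⟨(ofComponents ((componentsEquiv.symm x.1).take x.2)).numNodes,
      ofComponents ((componentsEquiv.symm x.1).take x.2),
      ofComponents ((componentsEquiv.symm x.1).drop x.2)⟩) ?_ ?_ ?_ ?_ ?_
  · rintro ⟨j, a, b⟩ h
    simp only [Finset.mem_sigma, Finset.mem_range, Finset.mem_product, mem_upper] at h ⊢
    obtain ⟨hj, ha, hb⟩ := h
    -- The leaf is determined by `a`, so `le_under_iff` applies at leaf `j`.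
    have hn : a.numNodes = j :=
      (numNodes_eq_of_le ha).symm.trans (numNodes_divide_fst (Nat.le_of_lt_succ hj))
    refine ⟨(le_under_iff t a b).2 ?_, ?_⟩
    · rw [hn]; exact ⟨ha, hb⟩
    · rw [componentsEquiv_symm_under, List.length_append]; omega
  · rintro ⟨s, i⟩ h
    simp only [Finset.mem_sigma, Finset.mem_range, Finset.mem_product, mem_upper] at h ⊢
    have hs := h.1
    rw [← hc s i, le_under_iff] at hs
    refine ⟨?_, hs.1, hs.2⟩
    have h1 := numNodes_eq_of_le h.1
    have h2 := congrArg numNodes (hc s i)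
    rw [numNodes_under] at h2
    omega
  · rintro ⟨j, a, b⟩ h
    simp only [Finset.mem_sigma, Finset.mem_range, Finset.mem_product, mem_upper] at h
    obtain ⟨hj, ha, hb⟩ := h
    have hn : a.numNodes = j :=
      (numNodes_eq_of_le ha).symm.trans (numNodes_divide_fst (Nat.le_of_lt_succ hj))
    simp only [componentsEquiv_symm_under, List.take_left, List.drop_left,
      ← componentsEquiv_apply, Equiv.apply_symm_apply, hn]
  · rintro ⟨s, i⟩ h
    simp only [Finset.mem_sigma, Finset.mem_range] at h
    refine Sigma.ext (hc s i) (heq_of_eq ?_)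
    simp only [← componentsEquiv_apply, Equiv.symm_apply_apply, List.length_take]
    omega
  · rintro ⟨j, a, b⟩ h
    simp only [componentsEquiv_symm_under, List.take_left, List.drop_left]

theorem F_nil : F nil = monomialBasis [] := by
  rw [← sum_M nil, monomialBasis_apply]
  refine (Finset.sum_eq_single nil (fun s hs h => ?_) (by simp)).trans rfl
  have := numNodes_eq_of_le (mem_upper.1 hs)
  cases s with
  | nil => exact absurd rfl h
  | node u l r => simp at this

theorem counit_monomialBasis (w : List {t : PBTree // t.IsProgressive}) :
    Coalgebra.counit (R := ℚ) (monomialBasis w) = if w = [] then 1 else 0 := by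
  cases w with
  | nil =>
    rw [← F_nil, counit_F]
    simp
  | cons a w =>
    rw [if_neg (List.cons_ne_nil a w), monomialBasis_apply, M_eq, map_sum]
    refine Finset.sum_eq_zero fun s hs => ?_
    rw [map_smul, counit_F, if_neg, smul_zero]
    rintro rfl
    have := numNodes_eq_of_le (mem_upper.1 hs)
    obtain ⟨l, hl⟩ := a.2.exists_eq
    rw [ofComponents_cons, numNodes_under, hl] at this
    simp at this

end YSym
-- Coordinate subspaces, tensor powers and words
namespace Module.Basis

variable {ι R N : Type*} [CommRing R] [AddCommGroup N] [Module R N]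

theorem isInternal_span_image [Nontrivial R] (b : Module.Basis ι R N) {κ : Type*} [DecidableEq κ]
    (f : ι → κ) :
    DirectSum.IsInternal fun k => Submodule.span R (b '' {i | f i = k}) := by
  rw [DirectSum.isInternal_submodule_iff_iSupIndep_and_iSup_eq_top]
  constructor
  · intro k
    refine (b.linearIndependent.disjoint_span_image
      (disjoint_compl_right (a := {i | f i = k}))).mono_right ?_
    refine iSup₂_le fun j hj => Submodule.span_mono (Set.image_mono ?_)
    rintro i rfl
    exact hj
  · rw [eq_top_iff, ← b.span_eq, Submodule.span_le]
    rintro _ ⟨i, rfl⟩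
    exact Submodule.mem_iSup_of_mem (f i) (Submodule.subset_span ⟨i, rfl, rfl⟩)

/-- Turns a computation of a subspace as a span of basis vectors into a basis of it with prescribed
members. -/
theorem exists_basis_of_eq_span (b : Module.Basis ι R N) {κ : Type*} {e : κ → ι}
    (he : Function.Injective e) {S : Submodule R N}
    (hS : S = Submodule.span R (b '' Set.range e)) :
    ∃ c : Module.Basis κ R S, ∀ t, (c t : N) = b (e t) := by
  rw [← Set.range_comp] at hS
  refine ⟨(Module.Basis.span (b.linearIndependent.comp e he)).map (LinearEquiv.ofEq _ _ hS.symm),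
    fun t => ?_⟩
  rw [Module.Basis.map_apply, LinearEquiv.coe_ofEq_apply, Module.Basis.span_apply]
  rfl

theorem eq_span_image_of_coord (b : Module.Basis ι R N) {P : ι → Prop} {S : Submodule R N}
    (hS : ∀ x, x ∈ S ↔ ∀ i, b.coord i x ≠ 0 → P i) :
    S = Submodule.span R (b '' {i | P i}) := by
  ext x
  rw [hS, b.mem_span_image]
  exact forall_congr' fun i => by rw [Finset.mem_coe, Finsupp.mem_support_iff]; rfl

open Classical in
theorem coord_self_apply (b : Module.Basis ι R N) (u w : ι) :
    b.coord u (b w) = if w = u then 1 else 0 := by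
  rw [Module.Basis.coord_apply, Module.Basis.repr_self, Finsupp.single_apply]

end Module.Basis

section TensorPower

variable {C : Type*} [AddCommGroup C] [Module ℚ C]

/-- The basis of `C^{⊗k}` formed by the tensor products of basis elements. -/
noncomputable def tensorPowerBasis {ι : Type*} (b : Module.Basis ι ℚ C) (k : ℕ) :
    Module.Basis (Fin k → ι) ℚ (⨂[ℚ]^k C) :=
  Basis.piTensorProduct fun _ => b

theorem tensorPowerBasis_coord_tprod {ι : Type*} (b : Module.Basis ι ℚ C) {k : ℕ} (p : Fin k → ι)
    (v : Fin k → C) :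
    (tensorPowerBasis b k).coord p (PiTensorProduct.tprod ℚ v) = ∏ i, b.coord (p i) (v i) :=
  Basis.piTensorProduct_repr_tprod_apply _ _ _

/-- Supplies the inductive step for coordinates of the iterated coproduct; both sides are linear, so
pure tensors suffice. -/
theorem tensorPowerBasis_coord_mulEquiv {ι : Type*} (b : Module.Basis ι ℚ C) {k l : ℕ}
    (p : Fin k → ι) (q : Fin l → ι) (z : ⨂[ℚ]^k C ⊗[ℚ] ⨂[ℚ]^l C) :
    (tensorPowerBasis b (k + l)).coord (Fin.append p q) (TensorPower.mulEquiv z) =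
      LinearMap.mul' ℚ ℚ (TensorProduct.map ((tensorPowerBasis b k).coord p)
        ((tensorPowerBasis b l).coord q) z) := by
  suffices H : (tensorPowerBasis b (k + l)).coord (Fin.append p q) ∘ₗ
      TensorPower.mulEquiv.toLinearMap = LinearMap.mul' ℚ ℚ ∘ₗ
        TensorProduct.map ((tensorPowerBasis b k).coord p) ((tensorPowerBasis b l).coord q) from
    LinearMap.congr_fun H z
  refine TensorProduct.ext (PiTensorProduct.ext (MultilinearMap.ext fun v => ?_))
  refine PiTensorProduct.ext (MultilinearMap.ext fun w => ?_)
  change (tensorPowerBasis b (k + l)).coord (Fin.append p q)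
    (TensorPower.mulEquiv (PiTensorProduct.tprod ℚ v ⊗ₜ PiTensorProduct.tprod ℚ w)) =
    (tensorPowerBasis b k).coord p (PiTensorProduct.tprod ℚ v) *
      (tensorPowerBasis b l).coord q (PiTensorProduct.tprod ℚ w)
  rw [← TensorPower.gMul_def, TensorPower.tprod_mul_tprod, tensorPowerBasis_coord_tprod,
    tensorPowerBasis_coord_tprod, tensorPowerBasis_coord_tprod, Fin.prod_univ_add]
  simp only [Fin.append_left, Fin.append_right]

/-- A coordinate of a pure tensor is a product, and its `i`-th factor vanishes unless `p i = j`. The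
sum defining a coradical level is therefore a coordinate subspace. -/
theorem iSup_span_tprod_eq {ι : Type*} (b : Module.Basis ι ℚ C) (j : ι) (k : ℕ) :
    (⨆ i : Fin k, Submodule.span ℚ {x | ∃ v : Fin k → C, v i ∈ Submodule.span ℚ {b j} ∧
      x = PiTensorProduct.tprod ℚ v}) =
    Submodule.span ℚ (tensorPowerBasis b k '' {p | ∃ i, p i = j}) := by
  apply le_antisymm
  · refine iSup_le fun i => Submodule.span_le.2 ?_
    rintro _ ⟨v, hv, rfl⟩
    obtain ⟨c, hc⟩ := Submodule.mem_span_singleton.1 hv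
    refine (Module.Basis.mem_span_image _).2 fun p hp => ⟨i, ?_⟩
    rw [Finset.mem_coe, Finsupp.mem_support_iff] at hp
    by_contra hj
    refine hp ((tensorPowerBasis_coord_tprod b p v).trans
      (Finset.prod_eq_zero (Finset.mem_univ i) ?_))
    rw [← hc, map_smul, Module.Basis.coord_self_apply, if_neg (Ne.symm hj), smul_zero]
  · rw [Submodule.span_le]
    rintro _ ⟨p, ⟨i, hi⟩, rfl⟩
    refine Submodule.mem_iSup_of_mem i (Submodule.subset_span ⟨fun i => b (p i), ?_,
      Basis.piTensorProduct_apply _ _⟩)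
    exact Submodule.mem_span_singleton.2 ⟨1, by simp only [one_smul, hi]⟩

end TensorPower

namespace List

variable {A : Type*}

/-- Split off single letters and let the last piece take the rest. With the next lemma: a word
splits into `k + 1` nonempty words exactly when its length exceeds `k`. -/
theorem exists_flatten_ofFn_eq {k : ℕ} {w : List A} (hw : k < w.length) :
    ∃ p : Fin (k + 1) → List A, (List.ofFn p).flatten = w ∧ ∀ i, p i ≠ [] := by
  induction k generalizing w with
  | zero => exact ⟨fun _ => w, by simp, fun _ => List.ne_nil_of_length_pos hw⟩
  | succ k ih =>
    obtain _ | ⟨a, w⟩ := w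
    · simp at hw
    obtain ⟨p, hp, hp'⟩ := ih (w := w) (by simpa using hw)
    refine ⟨Fin.cons [a] p, ?_, Fin.cases (by simp) (by simpa using hp')⟩
    rw [List.ofFn_cons, List.flatten_cons, hp, List.singleton_append]

theorem le_length_flatten_ofFn {k : ℕ} {p : Fin k → List A} (hp : ∀ i, p i ≠ []) :
    k ≤ (List.ofFn p).flatten.length := by
  rw [List.length_flatten]
  calc k = ((List.ofFn p).map List.length).length := by simp
    _ ≤ _ := List.length_le_sum_of_one_le _ fun n hn => by
      obtain ⟨_, hl, rfl⟩ := List.mem_map.1 hn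
      obtain ⟨i, rfl⟩ := (List.mem_ofFn' _ _).1 hl
      exact List.length_pos_iff.2 (hp i)

end List

/-! ### Coalgebras with a deconcatenation basis -/

section Deconcatenation

variable {C : Type*} [AddCommGroup C] [Module ℚ C] [Coalgebra ℚ C] {A : Type*}

/-- The coproduct is deconcatenation on a basis indexed by words. -/
def IsDeconcatenation (m : Module.Basis (List A) ℚ C) : Prop :=
  ∀ w, Coalgebra.comul (R := ℚ) (m w) =
    ∑ i ∈ Finset.range (w.length + 1), m (w.take i) ⊗ₜ[ℚ] m (w.drop i)

variable {m : Module.Basis (List A) ℚ C}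

namespace IsDeconcatenation

theorem isCoalgebraGrading
    (h : IsDeconcatenation m)
    (hε : ∀ w, Coalgebra.counit (R := ℚ) (m w) = if w = [] then 1 else 0) :
    IsCoalgebraGrading fun k => Submodule.span ℚ (m '' {w | w.length = k}) where
  isInternal := m.isInternal_span_image List.length
  comul_le k := by
    rw [Submodule.map_span_le]
    rintro _ ⟨w, rfl, rfl⟩
    rw [h w]
    refine Submodule.sum_mem _ fun i hi => ?_
    rw [Finset.mem_range] at hi
    refine Submodule.mem_iSup_of_mem (i, w.length - i) (Submodule.mem_iSup_of_mem
      (Finset.HasAntidiagonal.mem_antidiagonal.2 (Nat.add_sub_of_le (Nat.le_of_lt_succ hi))) ?_)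
    exact ⟨⟨m (w.take i), Submodule.subset_span ⟨_, by
      simp only [Set.mem_ofPred_eq, List.length_take]; omega, rfl⟩⟩ ⊗ₜ
      ⟨m (w.drop i), Submodule.subset_span ⟨_, by simp, rfl⟩⟩, rfl⟩
  counit_eq_zero k hk x hx := by
    induction hx using Submodule.span_induction with
    | mem x hx =>
      obtain ⟨w, rfl, rfl⟩ := hx
      rw [hε, if_neg]
      rintro rfl
      exact hk rfl
    | zero => exact map_zero _
    | add x y _ _ hx hy => rw [map_add, hx, hy, add_zero]
    | smul c x _ hx => rw [map_smul, hx, smul_zero]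

/-- The coproduct is dual to concatenation of words. -/
theorem coord_comul (h : IsDeconcatenation m) (u v : List A) (x : C) :
    LinearMap.mul' ℚ ℚ (TensorProduct.map (m.coord u) (m.coord v) (Coalgebra.comul (R := ℚ) x)) =
      m.coord (u ++ v) x := by
  classical
  suffices H : LinearMap.mul' ℚ ℚ ∘ₗ TensorProduct.map (m.coord u) (m.coord v) ∘ₗ
      Coalgebra.comul (R := ℚ) = m.coord (u ++ v) from LinearMap.congr_fun H x
  refine m.ext fun w => ?_
  simp only [LinearMap.comp_apply, h w, map_sum, TensorProduct.map_tmul, LinearMap.mul'_apply,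
    Module.Basis.coord_self_apply]
  split_ifs with hw
  · subst hw
    -- Only the cut after `u` has `u` as its left part.
    rw [Finset.sum_eq_single u.length]
    · simp
    · intro i hi hu
      rw [if_neg, zero_mul]
      intro hi'
      have := congrArg List.length hi'
      rw [List.length_take] at this
      rw [Finset.mem_range] at hi
      omega
    · simp
  · refine Finset.sum_eq_zero fun i _ => ?_
    rw [mul_ite, mul_one, mul_zero, ← ite_and, if_neg]
    rintro ⟨hv, hu⟩
    exact hw (by rw [← hu, ← hv, List.take_append_drop])

/-- For nonempty `u`, `v` the coordinate of `x ⊗ 1 + 1 ⊗ x` at `(u, v)` vanishes, and it equals the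
coordinate of `x` at `u ++ v`; so no word of length two or more occurs in a primitive `x`. -/
theorem primitives_eq (h : IsDeconcatenation m) :
    primitives (m []) = Submodule.span ℚ (m '' {w | w.length = 1}) := by
  apply le_antisymm
  · intro x hx
    have hx' : Coalgebra.comul (R := ℚ) x = x ⊗ₜ[ℚ] m [] + m [] ⊗ₜ[ℚ] x := hx
    have key (u v : List A) := h.coord_comul u v x
    simp only [hx', map_add, TensorProduct.map_tmul, LinearMap.mul'_apply,
      Module.Basis.coord_self_apply] at key
    rw [m.mem_span_image]
    intro w hw
    rw [Finset.mem_coe, Finsupp.mem_support_iff] at hw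
    match w, hw with
    | [], hw =>
      -- The coordinate `c` at the empty word satisfies `c + c = c`.
      have := key [] []
      simp only [if_true, mul_one, one_mul, List.append_nil] at this
      exact absurd (add_eq_left.1 this) hw
    | [a], _ => rfl
    | a :: b :: w, hw =>
      have := key [a] (b :: w)
      simp at this
      exact absurd this.symm hw
  · rw [Submodule.span_le]
    rintro _ ⟨w, hw, rfl⟩
    obtain ⟨a, rfl⟩ := List.length_eq_one_iff.1 hw
    change Coalgebra.comul (R := ℚ) (m [a]) = _
    rw [h]
    simp [Finset.sum_range_succ, add_comm]

/-- The iterated coproduct is dual to iterated concatenation of words. -/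
theorem coord_iterComul (h : IsDeconcatenation m) (k : ℕ) (p : Fin (k + 1) → List A) (x : C) :
    (tensorPowerBasis m (k + 1)).coord p (iterComul C k x) =
      m.coord (List.ofFn p).flatten x := by
  have h1 (q : Fin 1 → List A) : (tensorPowerBasis m 1).coord q ∘ₗ
      (PiTensorProduct.subsingletonEquiv (R := ℚ) (s := fun _ : Fin 1 => C) 0).symm.toLinearMap =
        m.coord (q 0) := by
    refine LinearMap.ext fun x => ?_
    rw [LinearMap.comp_apply, LinearEquiv.coe_coe, PiTensorProduct.subsingletonEquiv_symm_apply',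
      tensorPowerBasis_coord_tprod, Fin.prod_univ_one]
  induction k generalizing x with
  | zero =>
    refine (LinearMap.congr_fun (h1 p) x).trans ?_
    simp
  | succ k ih =>
    -- The last entry is separated because `iterComul` iterates on the left tensor factor.
    obtain ⟨q, r, rfl⟩ : ∃ (q : Fin (k + 1) → List A) (r : Fin 1 → List A), p = Fin.append q r :=
      ⟨_, _, (Fin.append_castAdd_natAdd (m := k + 1) (n := 1) (f := p)).symm⟩
    have h2 : (tensorPowerBasis m (k + 1)).coord q ∘ₗ iterComul C k =
        m.coord (List.ofFn q).flatten := LinearMap.ext (ih q)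
    rw [iterComul, LinearMap.comp_apply, LinearMap.comp_apply, LinearEquiv.coe_coe,
      tensorPowerBasis_coord_mulEquiv, ← LinearMap.comp_apply (TensorProduct.map _ _),
      ← TensorProduct.map_comp, h1, h2, h.coord_comul, List.ofFn_fin_append]
    simp

/-- By `coord_iterComul`, membership means that no word with a nonzero coordinate in `x` splits into
`k + 1` nonempty words. -/
theorem coradicalLevel_eq (h : IsDeconcatenation m) (k : ℕ) :
    coradicalLevel (Submodule.span ℚ {m []}) k =
      Submodule.span ℚ (m '' {w | w.length ≤ k}) := by
  refine m.eq_span_image_of_coord fun x => ?_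
  rw [coradicalLevel, Submodule.mem_comap, iSup_span_tprod_eq, Module.Basis.mem_span_image]
  constructor
  · intro hx w hw
    by_contra hk
    obtain ⟨p, rfl, hp⟩ := List.exists_flatten_ofFn_eq (not_le.1 hk)
    rw [← h.coord_iterComul] at hw
    obtain ⟨i, hi⟩ := hx (Finset.mem_coe.2 (Finsupp.mem_support_iff.2 hw))
    exact hp i hi
  · intro hx p hp
    rw [Finset.mem_coe, Finsupp.mem_support_iff, ← Module.Basis.coord_apply,
      h.coord_iterComul] at hp
    by_contra hn
    have := hx _ hp
    have := List.le_length_flatten_ofFn (p := p) fun i hi => hn ⟨i, hi⟩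
    omega

end IsDeconcatenation

end Deconcatenation
-- The word basis of `Q(V)` and the comparison isomorphism
namespace Cofree

variable {V : Type*} [AddCommGroup V] [Module ℚ V] {ι : Type*}

/-- The basis of `Q(V)` formed by the tensor products of basis elements of `V`. -/
noncomputable def sigmaBasis (b : Module.Basis ι ℚ V) :
    Module.Basis (Σ k, Fin k → ι) ℚ (Cofree V) :=
  DFinsupp.basis fun k => tensorPowerBasis b k

/-- The basis of `Q(V)` formed by the words in basis elements of `V`. -/
noncomputable def basis (b : Module.Basis ι ℚ V) : Module.Basis (List ι) ℚ (Cofree V) :=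
  (sigmaBasis b).reindex List.equivSigmaTuple.symm

theorem basis_ofFn (b : Module.Basis ι ℚ V) {k : ℕ} (p : Fin k → ι) :
    basis b (List.ofFn p) = tensor V k fun i => b (p i) := by
  have h : List.equivSigmaTuple (List.ofFn p) = ⟨k, p⟩ :=
    List.equivSigmaTuple.apply_symm_apply ⟨k, p⟩
  rw [basis, Module.Basis.reindex_apply, Equiv.symm_symm, h, Module.Basis.apply_eq_iff]
  have h2 : tensor V k (fun i => b (p i)) = DFinsupp.single k (tensorPowerBasis b k p) :=
    congrArg (incl V k) (Basis.piTensorProduct_apply _ _).symm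
  -- The basis of a direct sum is given by its coordinate map, so the coordinates of the tensor are
  -- computed instead.
  change (sigmaFinsuppLequivDFinsupp ℚ).symm (DFinsupp.mapRange.linearEquiv
    (fun i => (tensorPowerBasis b i).repr) (tensor V k fun i => b (p i))) = _
  rw [h2, LinearEquiv.symm_apply_eq, DFinsupp.mapRange.linearEquiv_apply, DFinsupp.mapRange_single,
    Module.Basis.repr_self]
  exact (sigmaFinsuppEquivDFinsupp_single (N := ℚ) (⟨k, p⟩ : Σ k, Fin k → ι) 1).symm

theorem basis_apply (b : Module.Basis ι ℚ V) (w : List ι) : basis b w = word (w.map b) := by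
  have h := basis_ofFn b w.get
  rw [List.ofFn_get, tensor_eq_word] at h
  rw [h, ← List.ofFn_get w, List.map_ofFn, List.ofFn_get]
  rfl

theorem homogeneous_eq_span (b : Module.Basis ι ℚ V) (k : ℕ) :
    homogeneous V k = Submodule.span ℚ (basis b '' {w | w.length = k}) := by
  rw [homogeneous, LinearMap.range_eq_map, ← (tensorPowerBasis b k).span_eq, Submodule.map_span,
    ← Set.range_comp]
  congr 1
  have h (p : Fin k → ι) : incl V k (tensorPowerBasis b k p) = basis b (List.ofFn p) :=
    (congrArg (incl V k) (Basis.piTensorProduct_apply _ _)).trans (basis_ofFn b p).symm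
  ext x
  constructor
  · rintro ⟨p, rfl⟩
    exact ⟨_, List.length_ofFn, (h p).symm⟩
  · rintro ⟨w, rfl, rfl⟩
    exact ⟨w.get, (h _).trans (by rw [List.ofFn_get])⟩

theorem isDeconcatenation_basis (b : Module.Basis ι ℚ V) : IsDeconcatenation (basis b) := by
  intro w
  simp only [basis_apply, comul_word, List.length_map, List.map_take, List.map_drop]

theorem counit_basis (b : Module.Basis ι ℚ V) (w : List ι) :
    Coalgebra.counit (R := ℚ) (basis b w) = if w = [] then 1 else 0 := by
  simp only [basis_apply, counit_word, List.length_map, List.length_eq_zero_iff]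

end Cofree

/-- Two coalgebras with deconcatenation bases indexed by the same words are isomorphic. -/
noncomputable def IsDeconcatenation.coalgEquiv {C D A : Type*} [AddCommGroup C] [Module ℚ C]
    [Coalgebra ℚ C] [AddCommGroup D] [Module ℚ D] [Coalgebra ℚ D] {m : Module.Basis (List A) ℚ C}
    {n : Module.Basis (List A) ℚ D} (hm : IsDeconcatenation m) (hn : IsDeconcatenation n)
    (h : ∀ w, Coalgebra.counit (R := ℚ) (m w) = Coalgebra.counit (R := ℚ) (n w)) :
    C ≃ₗc[ℚ] D :=
  { m.equiv n (Equiv.refl _) with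
    counit_comp := m.ext fun w => by
      change Coalgebra.counit (R := ℚ) (m.equiv n (Equiv.refl _) (m w)) = _
      rw [Module.Basis.equiv_apply, h]
      rfl
    map_comp_comul := m.ext fun w => by
      change TensorProduct.map (m.equiv n (Equiv.refl _)).toLinearMap
        (m.equiv n (Equiv.refl _)).toLinearMap (Coalgebra.comul (R := ℚ) (m w)) =
          Coalgebra.comul (R := ℚ) (m.equiv n (Equiv.refl _) (m w))
      simp only [hm w, map_sum, TensorProduct.map_tmul, LinearEquiv.coe_coe,
        Module.Basis.equiv_apply, Equiv.refl_apply, hn w] }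

theorem IsDeconcatenation.coalgEquiv_apply {C D A : Type*} [AddCommGroup C] [Module ℚ C]
    [Coalgebra ℚ C] [AddCommGroup D] [Module ℚ D] [Coalgebra ℚ D]
    {m : Module.Basis (List A) ℚ C} {n : Module.Basis (List A) ℚ D}
    (hm : IsDeconcatenation m) (hn : IsDeconcatenation n)
    (h : ∀ w, Coalgebra.counit (R := ℚ) (m w) = Coalgebra.counit (R := ℚ) (n w)) (w : List A) :
    hm.coalgEquiv hn h (m w) = n w :=
  m.equiv_apply w n (Equiv.refl _)

/-! ### Translation from words back to trees -/

namespace YSym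

open PBTree

theorem span_M_image (P : ℕ → Prop) :
    Submodule.span ℚ (M '' {t | P (componentsEquiv.symm t).length}) =
      Submodule.span ℚ (monomialBasis '' {w | P w.length}) := by
  congr 1
  ext x
  constructor
  · rintro ⟨t, ht, rfl⟩
    exact ⟨_, ht, monomialBasis_symm_apply t⟩
  · rintro ⟨w, hw, rfl⟩
    refine ⟨componentsEquiv w, ?_, (monomialBasis_apply w).symm⟩
    rwa [Set.mem_ofPred_eq, Equiv.symm_apply_apply]

theorem componentGrading_eq (k : ℕ) :
    componentGrading k = Submodule.span ℚ (monomialBasis '' {w | w.length = k}) := by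
  rw [← span_M_image (· = k), componentGrading]
  simp only [hasComponents_iff]

theorem ofComponents_singleton (t : {t : PBTree // t.IsProgressive}) :
    ofComponents [t] = t :=
  under_nil _

theorem range_singleton {A : Type*} :
    Set.range (fun a : A => [a]) = {w : List A | w.length = 1} := by
  ext w
  simp [List.length_eq_one_iff, eq_comm]

/-- Progressive trees are the one-letter words, so the `M t` with `t` progressive form a basis of
`V`. -/
theorem progressiveSpan_eq :
    progressiveSpan = Submodule.span ℚ (monomialBasis '' Set.range fun a => [a]) := by
  rw [progressiveSpan, ← Set.range_comp, Set.image_eq_range]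
  congr 2
  funext t
  exact ((monomialBasis_apply _).trans (congrArg M (ofComponents_singleton t))).symm

theorem isDeconcatenation_monomialBasis : IsDeconcatenation monomialBasis :=
  comul_monomialBasis

/-- Identifies the coradical with the line of the empty word, as `coradicalLevel_eq` requires. -/
theorem homogeneous_zero : homogeneous 0 = Submodule.span ℚ {monomialBasis []} := by
  rw [homogeneous, ← F_nil, ← Set.image_singleton]
  congr 2
  ext t
  cases t <;> simp

end YSym

open YSym PBTree in
theorem theorem5p2 :
    IsCoalgebraGrading YSym.componentGrading ∧
    (∃ e : Cofree YSym.progressiveSpan ≃ₗc[ℚ] YSym,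
      (∀ k : ℕ, (Cofree.homogeneous YSym.progressiveSpan k).map (e : _ →ₗ[ℚ] YSym) =
        YSym.componentGrading k) ∧
      ∀ (k : ℕ) (t : Fin k → {t : PBTree // t.IsProgressive}),
        e (Cofree.tensor YSym.progressiveSpan k fun i => YSym.progressiveM (t i)) =
          YSym.M (PBTree.underList (List.ofFn fun i => (t i : PBTree)))) ∧
    (∃ b : Module.Basis {t : PBTree // t.IsProgressive} ℚ (primitives (YSym.F BinaryTree.nil)),
      ∀ t, (b t : YSym) = YSym.M t) ∧
    ∀ k : ℕ, ∃ b : Module.Basis {t : PBTree // ∃ j ≤ k, t.HasComponents j} ℚ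
        (coradicalLevel (YSym.homogeneous 0) k),
      ∀ t, (b t : YSym) = YSym.M t := by
  have hm (t : {t : PBTree // t.IsProgressive}) : monomialBasis [t] = M t :=
    (monomialBasis_apply _).trans (congrArg M (ofComponents_singleton t))
  have hd := isDeconcatenation_monomialBasis
  refine ⟨?_, ?_, ?_, fun k => ?_⟩
  · rw [funext componentGrading_eq]
    exact hd.isCoalgebraGrading counit_monomialBasis
  -- With this basis of `V`, the word bases of `Q(V)` and `YSym` share the alphabet of progressive
  -- trees.
  · obtain ⟨b, hb⟩ := monomialBasis.exists_basis_of_eq_span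
      (List.singleton_injective) progressiveSpan_eq
    have hb' (t) : b t = progressiveM t := Subtype.ext ((hb t).trans (hm t))
    let e := (Cofree.isDeconcatenation_basis b).coalgEquiv hd
      fun w => (Cofree.counit_basis b w).trans (counit_monomialBasis w).symm
    have he (w) : e (Cofree.basis b w) = monomialBasis w :=
      IsDeconcatenation.coalgEquiv_apply _ _ _ w
    refine ⟨e, fun k => ?_, fun k t => ?_⟩
    · rw [Cofree.homogeneous_eq_span b, Submodule.map_span, componentGrading_eq, Set.image_image]
      exact congrArg _ (Set.image_congr fun w _ => he w)
    · simp only [← hb']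
      rw [← Cofree.basis_ofFn, he, monomialBasis_apply, ofComponents, List.map_ofFn]
      rfl
  · obtain ⟨b, hb⟩ := monomialBasis.exists_basis_of_eq_span (e := fun t => [t])
      (S := primitives (F nil)) List.singleton_injective
      (by rw [F_nil, hd.primitives_eq, range_singleton])
    exact ⟨b, fun t => (hb t).trans (hm t)⟩
  · obtain ⟨b, hb⟩ := monomialBasis.exists_basis_of_eq_span
      (e := fun t : {t : PBTree // ∃ j ≤ k, t.HasComponents j} => componentsEquiv.symm t.1)
      (S := coradicalLevel (homogeneous 0) k)
      (componentsEquiv.symm.injective.comp Subtype.val_injective) (by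
        rw [homogeneous_zero, hd.coradicalLevel_eq]
        congr 2
        ext w
        constructor
        · intro hw
          exact ⟨⟨componentsEquiv w, _, hw, (hasComponents_iff _ _).2 (by
            rw [Equiv.symm_apply_apply])⟩, Equiv.symm_apply_apply _ _⟩
        · rintro ⟨⟨t, j, hj, ht⟩, rfl⟩
          exact ((hasComponents_iff t j).1 ht).trans_le hj)
    exact ⟨b, fun t => (hb t).trans (monomialBasis_symm_apply t.1)⟩
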